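/- Let $p$ be a prime, let $G$ be a finite $p$-group and let $A\le\operatorname{Aut}(G)$. Commutators $[x,y]=x^{-1}y^{-1}xy$ are formed in the semidirect product of $G$ by $A$, and $[x_1,\dots,x_m]=[[x_1,\dots,x_{m-1}],x_m]$, $[x_1]=x_1$. Let $\gamma_p(G,A)$ be the subgroup of $G$ generated by all left normed commutators $[x_1,\dots,x_m]$ with $m\ge p$, $x_1\in G$, all $x_i\in G\cup A$, and at least $p-1$ of the $x_i$ in $A$. Assume that $A$ acts $p$-centrally on $\gamma_p(G,A)$, that is, every element of $A$ fixes every element of $\gamma_p(G,A)$ of order dividing $p$ (of order dividing $4$ if $p=2$). Let $H=[G,A]$ be the subgroup of $G$ generated by the elements $g^{-1}\sigma(g)$ with $g\in G$, $\sigma\in A$, and for an integer $n\ge 0$ let $\Omega_n(H)$ be the subgroup generated by the elements of $H$ of order dividing $p^n$. Then for every $\sigma\in A$ and every integer $n\ge 0$, $\sigma^{p^n}=1$ if and only if $\sigma$ acts trivially on $G/\Omega_n(H)$, that is, $g^{-1}\sigma(g)\in\Omega_n(H)$ for all $g\in G$. -/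

import Mathlib

namespace PCentral

/-- The left normed commutator `[x, y₁, …, yₘ]` in a group, defined by `[x] = x` and
`[x, y₁, …, yₘ] = [[x, y₁, …, yₘ₋₁], yₘ]`, where `[c, y] = c⁻¹ y⁻¹ c y`. -/
def leftNormed {K : Type*} [Group K] (x : K) (l : List K) : K :=
  l.foldl (fun c y => c⁻¹ * y⁻¹ * c * y) x

section Action

variable {G A : Type*} [Group G] [Group A] (φ : A →* MulAut G)

/-- An element of `G` or of `A`, viewed in the semidirect product of `G` by `A`. -/
def letter : G ⊕ A → G ⋊[φ] A
  | Sum.inl g => SemidirectProduct.inl g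
  | Sum.inr a => SemidirectProduct.inr a

/-- `γ_k(G, A)`: the subgroup of `G` generated by all left normed commutators `[x₁, …, xₘ]`,
with `x₁` in `G`, the other `xᵢ` in `G ∪ A`, and at least `k - 1` of them in `A`
(hence `m ≥ k`). The commutators are formed in the semidirect product of `G` by `A`; they all lie
in `G`, because `x₁` does. -/
def gammaSeries (k : ℕ) : Subgroup G :=
  Subgroup.closure {g : G | ∃ (x : G) (l : List (G ⊕ A)),
    k ≤ l.countP (fun z => z.isRight) + 1 ∧
    (SemidirectProduct.inl g : G ⋊[φ] A) =
      leftNormed (SemidirectProduct.inl x) (l.map (letter φ))}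

/-- `[G, A]`: the subgroup of `G` generated by the elements `g⁻¹ gᵃ`, with `g ∈ G`, `a ∈ A`. -/
def actionCommutator : Subgroup G :=
  Subgroup.closure {x : G | ∃ (g : G) (a : A), x = g⁻¹ * φ a g}

/-- `A` acts `p`-centrally on the subgroup `S` of `G`: it fixes every element of `S` of order
dividing `p` (dividing `4` if `p = 2`). -/
def ActsPCentrally (p : ℕ) (S : Subgroup G) : Prop :=
  ∀ x ∈ S, x ^ (if p = 2 then 4 else p) = 1 → ∀ a : A, φ a x = x

end Action

section Omega

variable {G : Type*} [Group G]

/-- `Ω_n(H)`: the subgroup generated by the elements of `H` of order dividing `p ^ n`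
(regarded as a subgroup of `G`). -/
def omega (p n : ℕ) (H : Subgroup G) : Subgroup G :=
  Subgroup.closure {h : G | h ∈ H ∧ h ^ p ^ n = 1}

/-- The automorphism `σ` of `G` acts trivially on `G / N`: it maps every coset `g N` to itself. -/
def ActsTriviallyOnQuotient (σ : MulAut G) (N : Subgroup G) : Prop :=
  ∀ g : G, (QuotientGroup.mk (σ g) : G ⧸ N) = QuotientGroup.mk g

end Omega

end PCentral

/-! In the semidirect product let `a` be `σ` and `z = g⁻¹ σ(g)`. Then `z a` is a conjugate of `a`,
and `(z a)^(p^n) = a^(p^n)` says exactly that `σ^(p^n)` fixes `g` (`inl_mul_inr_pow_eq_iff`). So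
everything rests on a regularity property: `(z a)^(p^n) = a^(p^n)` iff `z^(p^n) = 1`. The same
property shows that `Ω_n([G, A])` has exponent dividing `p^n`.

Regularity is proved for an abstract `CentralPair`. Let `p` be odd. If the commutator subgroup has
exponent `p`, the class is below `p` and `p`-th powers multiply, by a form of Hall's collection
formula. A minimality argument on two-generator subgroups supplies that exponent condition
(`commutator_pow_eq_one_of_proper_regular`). For `p = 2`, centrality of elements of order 4 gives a
direct argument. Powers `p^n` follow by induction, because dividing out the elements of `Q` of order
dividing `p` leaves a central pair (`CentralPair.quotient`). -/

namespace PCentral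

open scoped commutatorElement

/-! ### Polynomial sequences and Hall collection -/

section PolynomialSequences

variable {L : Type*} [Group L]

/-- The filtered group of polynomial sequences attached to a filtration `F`: `PolySeq F k` is
generated, under products, inverses, commutators and decrease of weight, by the sequences
`m ↦ c ^ (m choose j)`, where `c ∈ F (k + j)`. -/
inductive PolySeq (F : ℕ → Subgroup L) : ℕ → (ℕ → L) → Prop
  | gen (k j : ℕ) (c : L) (hc : c ∈ F (k + j)) : PolySeq F k (fun m => c ^ m.choose j)
  | mul {k : ℕ} {f g : ℕ → L} (hf : PolySeq F k f) (hg : PolySeq F k g) : PolySeq F k (f * g)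
  | inv {k : ℕ} {f : ℕ → L} (hf : PolySeq F k f) : PolySeq F k f⁻¹
  | comm {k l : ℕ} {f g : ℕ → L} (hf : PolySeq F k f) (hg : PolySeq F l g) :
      PolySeq F (k + l) ⁅f, g⁆
  | mono {k : ℕ} {f : ℕ → L} (hf : PolySeq F (k + 1) f) : PolySeq F k f

/-- The difference sequence `m ↦ f (m + 1) (f m)⁻¹`. -/
def diff (f : ℕ → L) : ℕ → L := fun m => f (m + 1) * (f m)⁻¹

namespace PolySeq

variable {F : ℕ → Subgroup L}

theorem of_le {k l : ℕ} {f : ℕ → L} (hkl : k ≤ l) (hf : PolySeq F l f) : PolySeq F k f := by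
  induction l, hkl using Nat.le_induction with
  | base => exact hf
  | succ l _ ih => exact ih hf.mono

theorem apply_mem (hF : Antitone F) (hcomm : ∀ i j, ⁅F i, F j⁆ ≤ F (i + j)) {k : ℕ} {f : ℕ → L}
    (hf : PolySeq F k f) (m : ℕ) : f m ∈ F k := by
  induction hf with
  | gen k j c hc => exact pow_mem (hF (Nat.le_add_right k j) hc) _
  | mul _ _ h1 h2 => exact mul_mem h1 h2
  | inv _ h => exact inv_mem h
  | comm _ _ h1 h2 => exact hcomm _ _ (Subgroup.commutator_mem_commutator h1 h2)
  | mono _ h => exact hF (Nat.le_succ _) h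

/-- The conjugate of `g` by `f`. -/
theorem conj {k l : ℕ} {f g : ℕ → L} (hf : PolySeq F k f) (hg : PolySeq F l g) :
    PolySeq F l (f * g * f⁻¹) := by
  have h : f * g * f⁻¹ = ⁅f, g⁆ * g := by simp [commutatorElement_def]
  rw [h]
  exact ((hf.comm hg).of_le (Nat.le_add_left l k)).mul hg

theorem diff {k : ℕ} {f : ℕ → L} (hf : PolySeq F k f) : PolySeq F (k + 1) (diff f) := by
  induction hf with
  | gen k j c hc =>
    cases j with
    | zero =>
      have h : PCentral.diff (fun m => c ^ m.choose 0) = fun m => (1 : L) ^ m.choose 0 := by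
        funext m; simp [PCentral.diff]
      rw [h]
      exact gen _ _ _ (one_mem _)
    | succ j =>
      have h : PCentral.diff (fun m => c ^ m.choose (j + 1)) = fun m => c ^ m.choose j := by
        funext m
        simp [PCentral.diff, Nat.choose_succ_succ, pow_add]
      rw [h]
      exact gen _ _ _ (by rwa [add_assoc, add_comm 1 j])
  | @mul k f g hf hg h1 h2 =>
    have h : PCentral.diff (f * g) = PCentral.diff f * (f * PCentral.diff g * f⁻¹) := by
      funext m; simp [PCentral.diff, mul_assoc]
    rw [h]
    exact h1.mul (hf.conj h2)
  | @inv k f hf h1 =>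
    have h : PCentral.diff f⁻¹ = f⁻¹ * (PCentral.diff f)⁻¹ * f⁻¹⁻¹ := by
      funext m; simp [PCentral.diff]
    rw [h]
    exact hf.inv.conj h1.inv
  | @comm k l f g hf hg h1 h2 =>
    set a := PCentral.diff f with ha
    set b := PCentral.diff g with hb
    have h : PCentral.diff ⁅f, g⁆ =
        a * (⁅f, b⁆ * (b * ⁅f, g⁆ * b⁻¹)) * a⁻¹ * (⁅a, b⁆ * (b * ⁅a, g⁆ * b⁻¹)) * ⁅f, g⁆⁻¹ := by
      funext m
      simp [ha, hb, PCentral.diff, commutatorElement_def, mul_assoc]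
    -- Moving `⁅f, g⁆` to the right cancels it against its inverse. Every remaining factor is a
    -- conjugate of a commutator involving `a` or `b`, so it has weight at least `k + l + 1`.
    have h' : PCentral.diff ⁅f, g⁆ =
        (a * ⁅f, b⁆ * a⁻¹) * (a * ⁅b, ⁅f, g⁆⁆ * a⁻¹) * ⁅a, ⁅f, g⁆⁆ *
          (⁅f, g⁆ * (⁅a, b⁆ * (b * ⁅a, g⁆ * b⁻¹)) * ⁅f, g⁆⁻¹) := by
      rw [h]
      simp [commutatorElement_def, mul_assoc]
    rw [h']
    have hfg := hf.comm hg
    refine ((PolySeq.mul ?_ ?_).mul ?_).mul (hfg.conj (PolySeq.mul ?_ ?_))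
    · exact h1.conj ((hf.comm h2).of_le (by omega))
    · exact h1.conj ((h2.comm hfg).of_le (by omega))
    · exact (h1.comm hfg).of_le (by omega)
    · exact (h1.comm h2).of_le (by omega)
    · exact h2.conj ((h1.comm hg).of_le (by omega))
  | mono _ h => exact h.mono

/-- Differencing raises the weight by one and shortens the initial run of trivial values by one,
while the first possibly nontrivial value is kept. -/
theorem apply_mem_of_forall_lt (hF : Antitone F) (hcomm : ∀ i j, ⁅F i, F j⁆ ≤ F (i + j)) (n : ℕ) :
    ∀ {k : ℕ} {f : ℕ → L}, PolySeq F k f → (∀ i < n, f i = 1) → f n ∈ F (k + n) := by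
  induction n with
  | zero => exact fun hf _ => hf.apply_mem hF hcomm 0
  | succ n ih =>
    intro k f hf h
    have h1 := ih hf.diff fun i hi => by simp [PCentral.diff, h i (by omega), h (i + 1) (by omega)]
    rw [PCentral.diff, h n (by omega), inv_one, mul_one] at h1
    rwa [show k + (n + 1) = k + 1 + n by omega]

theorem apply_prime_eq_one (hF : Antitone F) (hcomm : ∀ i j, ⁅F i, F j⁆ ≤ F (i + j)) {p : ℕ}
    (hp : p.Prime) (hbot : F p = ⊥) (hexp : ∀ c ∈ F 2, c ^ p = 1) {f : ℕ → L}
    (hf : PolySeq F 0 f) (h0 : f 0 = 1) (h1 : f 1 = 1) : f p = 1 := by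
  have key : ∀ n, 2 ≤ n → n ≤ p → ∃ g, PolySeq F 0 g ∧ (∀ i < n, g i = 1) ∧ g p = f p := by
    intro n hn
    induction n, hn using Nat.le_induction with
    | base =>
      refine fun _ => ⟨f, hf, fun i hi => ?_, rfl⟩
      interval_cases i <;> assumption
    | succ n hn ih =>
      intro hnp
      obtain ⟨g, hg, hlt, hgp⟩ := ih (by omega)
      have hc : g n ∈ F (0 + n) := apply_mem_of_forall_lt hF hcomm n hg hlt
      -- The correcting factor `(g n)^(-(m choose n))` kills the value at `n`. It is trivial for `m
      -- < n`, and also at `m = p`, since `p` divides `p choose n` and `g n` has order dividing `p`.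
      refine ⟨_, (PolySeq.gen 0 n (g n) hc).inv.mul hg, fun i hi => ?_, ?_⟩
      · rcases Nat.lt_succ_iff_lt_or_eq.mp hi with hi | rfl
        · simp [hlt i hi, Nat.choose_eq_zero_of_lt hi]
        · simp
      · obtain ⟨d, hd⟩ := hp.dvd_choose_self (by omega : n ≠ 0) (by omega)
        rw [Nat.zero_add] at hc
        simp [hgp, hd, pow_mul, hexp _ (hF hn hc)]
  obtain ⟨g, hg, hlt, hgp⟩ := key p hp.two_le le_rfl
  have := apply_mem_of_forall_lt hF hcomm p hg hlt
  rw [Nat.zero_add, hbot, Subgroup.mem_bot] at this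
  rw [← hgp, this]

end PolySeq

end PolynomialSequences

/-! ### The power map in groups of class less than `p` -/

section LowerCentralSeries

variable {L : Type*} [Group L]

theorem commutator_commutator_le_of_rotate {H₁ H₂ H₃ N : Subgroup L} [N.Normal]
    (h1 : ⁅⁅H₂, H₃⁆, H₁⁆ ≤ N) (h2 : ⁅⁅H₃, H₁⁆, H₂⁆ ≤ N) : ⁅⁅H₁, H₂⁆, H₃⁆ ≤ N := by
  have key : ∀ K : Subgroup L, K ≤ N ↔ K.map (QuotientGroup.mk' N) = ⊥ := fun K => by
    rw [Subgroup.map_eq_bot_iff, QuotientGroup.ker_mk']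
  rw [key] at h1 h2 ⊢
  simp only [Subgroup.map_commutator] at h1 h2 ⊢
  exact Subgroup.commutator_commutator_eq_bot_of_rotate h1 h2

theorem commutator_lowerCentralSeries_le (i j : ℕ) :
    ⁅(⊤ : Subgroup L).lowerCentralSeries i, (⊤ : Subgroup L).lowerCentralSeries j⁆ ≤
      (⊤ : Subgroup L).lowerCentralSeries (i + j + 1) := by
  induction i generalizing j with
  | zero => rw [Nat.zero_add, Subgroup.commutator_comm]; exact le_rfl
  | succ i ih =>
    refine commutator_commutator_le_of_rotate ?_ ?_
    · rw [Subgroup.commutator_comm ⊤, Subgroup.commutator_comm]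
      exact (ih (j + 1)).trans_eq (by congr 1; omega)
    · rw [Subgroup.commutator_comm (Subgroup.lowerCentralSeries ⊤ j)]
      exact (Subgroup.commutator_mono (ih j) le_rfl).trans_eq (by
        rw [← Subgroup.lowerCentralSeries_succ]; congr 1; omega)

/-- In a group of nilpotency class less than `p` whose commutator subgroup has exponent `p`, taking
`p`-th powers is a homomorphism. -/
theorem mul_pow_prime_of_lowerCentralSeries_eq_bot {p : ℕ} (hp : p.Prime)
    (hbot : (⊤ : Subgroup L).lowerCentralSeries (p - 1) = ⊥)
    (hexp : ∀ c ∈ commutator L, c ^ p = 1) (z x : L) : (z * x) ^ p = z ^ p * x ^ p := by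
  -- Truncated subtraction gives `F 0 = F 1 = ⊤`, so `m ↦ c ^ m` is polynomial for every `c`. The
  -- sequence used below is `(z x)^m x^(-m) z^(-m)`.
  set F : ℕ → Subgroup L := fun i => (⊤ : Subgroup L).lowerCentralSeries (i - 1)
  have hF : Antitone F := fun i j hij => Subgroup.lowerCentralSeries_antitone _ (by omega)
  have hcomm : ∀ i j, ⁅F i, F j⁆ ≤ F (i + j) := fun i j =>
    (commutator_lowerCentralSeries_le _ _).trans
      (Subgroup.lowerCentralSeries_antitone _ (by omega))
  have hpow : ∀ c : L, PolySeq F 0 (fun m => c ^ m.choose 1) := fun c =>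
    PolySeq.gen 0 1 c (Subgroup.mem_top c)
  have h := PolySeq.apply_prime_eq_one hF hcomm hp hbot hexp
    ((hpow (z * x)).mul ((hpow x).inv.mul (hpow z).inv)) (by simp) (by simp)
  simp only [Pi.mul_apply, Pi.inv_apply, Nat.choose_one_right] at h
  rwa [← mul_inv_rev, mul_inv_eq_one] at h

end LowerCentralSeries

/-! ### Regularity of `p`-th powers in central pairs -/

theorem commutator_le_of_closure_pair {P : Type*} [Group P] (E : Subgroup P) [E.Normal] {w v : P}
    (hwv : Subgroup.closure {w, v} = ⊤) (hw : ∀ g, ⁅w, g⁆ ∈ E) : commutator P ≤ E := by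
  have hC : ∀ a : P, w ∈ (Subgroup.centralizer {(a : P ⧸ E)}).comap (QuotientGroup.mk' E) →
      v ∈ (Subgroup.centralizer {(a : P ⧸ E)}).comap (QuotientGroup.mk' E) →
      ∀ g : P, ⁅g, a⁆ ∈ E := by
    intro a h1 h2 g
    have h : Subgroup.closure {w, v} ≤
        (Subgroup.centralizer {(a : P ⧸ E)}).comap (QuotientGroup.mk' E) := by
      rw [Subgroup.closure_le]
      rintro _ (rfl | rfl) <;> assumption
    have hg := h (hwv ▸ Subgroup.mem_top g)
    rw [Subgroup.mem_comap, Subgroup.mem_centralizer_singleton_iff] at hg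
    rw [← QuotientGroup.eq_one_iff]
    change ⁅(g : P ⧸ E), (a : P ⧸ E)⁆ = 1
    rw [commutatorElement_eq_one_iff_mul_comm]
    exact hg
  have hcomm : ∀ a b : P, ⁅a, b⁆ ∈ E →
      a ∈ (Subgroup.centralizer {(b : P ⧸ E)}).comap (QuotientGroup.mk' E) := by
    intro a b hab
    rw [← QuotientGroup.eq_one_iff] at hab
    change ⁅(a : P ⧸ E), (b : P ⧸ E)⁆ = 1 at hab
    rw [commutatorElement_eq_one_iff_mul_comm] at hab
    rw [Subgroup.mem_comap, Subgroup.mem_centralizer_singleton_iff]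
    exact hab
  have hv : ∀ g, ⁅g, v⁆ ∈ E := hC v (hcomm _ _ (hw v)) (hcomm _ _ (by simp))
  have hall : ∀ a g, ⁅g, a⁆ ∈ E := fun a => hC a (hcomm _ _ (hw a)) (hcomm _ _ (by
    rw [← commutatorElement_inv]; exact inv_mem (hv a)))
  rw [commutator_def, Subgroup.commutator_le]
  exact fun a _ b _ => hall b a

/-- `Q` is a normal `p`-subgroup of `P` and `N` a normal subgroup of `P` contained in `Q`, such that
the elements of `N` of order dividing `p` (dividing `4` if `p = 2`) are central in `P`, and `N`
contains the `(p - 1)`-st term of the lower central series of `P` (contains `Q` if `p = 2`). -/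
structure CentralPair (p : ℕ) {P : Type*} [Group P] (Q N : Subgroup P) : Prop where
  normal_left : Q.Normal
  normal_right : N.Normal
  le : N ≤ Q
  isPGroup : IsPGroup p Q
  le_of_two : p = 2 → Q ≤ N
  lowerCentralSeries_le : p ≠ 2 → (⊤ : Subgroup P).lowerCentralSeries (p - 2) ≤ N
  central : ∀ x ∈ N, x ^ (if p = 2 then 4 else p) = 1 → ∀ g, Commute x g

namespace CentralPair

variable {p : ℕ} {P : Type*} [Group P] {Q N : Subgroup P}

theorem subgroupOf (h : CentralPair p Q N) (R : Subgroup P) :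
    CentralPair p (Q.subgroupOf R) (N.subgroupOf R) where
  normal_left := h.normal_left.comap _
  normal_right := h.normal_right.comap _
  le := Subgroup.comap_mono h.le
  isPGroup := h.isPGroup.comap_subtype
  le_of_two hp := Subgroup.comap_mono (h.le_of_two hp)
  lowerCentralSeries_le hp := by
    rw [Subgroup.subgroupOf, ← Subgroup.map_le_iff_le_comap,
      Subgroup.top_subtype_lowerCentralSeries]
    exact (Subgroup.lowerCentralSeries_mono _ le_top).trans (h.lowerCentralSeries_le hp)
  central x hx hxp g :=
    Subtype.ext (h.central x hx (congrArg Subtype.val hxp) g)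

theorem restrict (h : CentralPair p Q N) : CentralPair p (⊤ : Subgroup Q) (N.subgroupOf Q) := by
  simpa using h.subgroupOf Q

/-- The `(p - 2)`-nd lower central term lies in `N` and has exponent `p`, hence is central, so the
next term vanishes. -/
theorem mul_pow_prime (h : CentralPair p Q N) (hp : p.Prime) (hp2 : p ≠ 2)
    (hexp : ∀ c ∈ commutator P, c ^ p = 1) (z x : P) : (z * x) ^ p = z ^ p * x ^ p := by
  refine mul_pow_prime_of_lowerCentralSeries_eq_bot hp ?_ hexp z x
  have hp3 := hp.two_le
  rw [show p - 1 = p - 2 + 1 by omega, Subgroup.lowerCentralSeries_succ, eq_bot_iff,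
    Subgroup.commutator_le]
  intro c hc g _
  have hc' : c ∈ commutator P := by
    rw [← Subgroup.top_lowerCentralSeries_one]
    exact Subgroup.lowerCentralSeries_antitone _ (by omega) hc
  rw [Subgroup.mem_bot, commutatorElement_eq_one_iff_commute]
  exact h.central c (h.lowerCentralSeries_le hp2 hc) (by simpa [hp2] using hexp c hc') g

/-- The hypothesis makes `x` invert `z`. A power of `z` of order dividing 4 is central, so it equals
its own inverse; descending through the powers `z^(2^k)` ends at `z^2 = 1`. -/
theorem sq_eq_one_of_mul_sq (h : CentralPair 2 Q N) {z x : P} (hz : z ∈ Q)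
    (hzx : (z * x) ^ 2 = x ^ 2) : z ^ 2 = 1 := by
  have hinv : x⁻¹ * z * x = z⁻¹ := by
    have : z * x * z = x := by
      rw [sq, sq, ← mul_assoc] at hzx
      exact mul_right_cancel hzx
    rw [eq_inv_iff_mul_eq_one, mul_assoc, mul_assoc, ← mul_assoc z, this, inv_mul_cancel]
  have key : ∀ k, z ^ 2 ^ (k + 1) = 1 → z ^ 2 = 1 := by
    intro k
    induction k with
    | zero => exact fun hk => by simpa using hk
    | succ k ih =>
      intro hk
      refine ih ?_
      have hu4 : (z ^ 2 ^ k) ^ 4 = 1 := by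
        rw [← pow_mul, ← hk]; congr 1; ring
      have hu := h.central _ (h.le_of_two rfl (pow_mem hz _)) (by simpa using hu4) x
      have h1 : x⁻¹ * z ^ 2 ^ k * x = (z ^ 2 ^ k)⁻¹ := by
        have := conj_pow (i := 2 ^ k) (a := x⁻¹) (b := z)
        rw [inv_inv, hinv, inv_pow] at this
        exact this.symm
      rw [mul_assoc, hu.eq, inv_mul_cancel_left, eq_inv_iff_mul_eq_one, ← pow_add] at h1
      rw [← h1]; congr 1; ring
  obtain ⟨k, hk⟩ := h.isPGroup ⟨z, hz⟩
  refine key k ?_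
  have hk' : z ^ 2 ^ k = 1 := by simpa using congrArg Subtype.val hk
  rw [pow_succ, pow_mul, hk', one_pow]

theorem mul_sq_eq (h : CentralPair 2 Q N) {z : P} (x : P) (hz : z ∈ Q) (hz2 : z ^ 2 = 1) :
    (z * x) ^ 2 = x ^ 2 := by
  have hc := h.central z (h.le_of_two rfl hz) (by
    rw [if_pos rfl, show 4 = 2 * 2 from rfl, pow_mul, hz2, one_pow]) x
  rw [hc.mul_pow, hz2, one_mul]

end CentralPair

/-- Maximal subgroups of a nilpotent group are normal, so one containing `w` would contain its
normal closure. -/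
theorem zpowers_eq_top_of_normalClosure_eq_top {P : Type*} [Group P] [Finite P]
    [Group.IsNilpotent P] {w : P} (hw : Subgroup.normalClosure {w} = ⊤) :
    Subgroup.zpowers w = ⊤ := by
  by_contra hne
  obtain ⟨M, hM, hle⟩ := (eq_top_or_exists_le_coatom (Subgroup.zpowers w)).resolve_left hne
  have := Subgroup.NormalizerCondition.normal_of_coatom M
    Group.normalizerCondition_of_isNilpotent hM
  refine hM.1 (eq_top_iff.mpr (hw ▸ Subgroup.normalClosure_le_normal ?_))
  simpa using hle (Subgroup.mem_zpowers w)

/-- In a `p`-group generated by two elements, one of which has a central `p`-th power, all elements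
of the commutator subgroup have order dividing `p`, provided that proper subgroups are regular. -/
theorem commutator_pow_eq_one_of_proper_regular {p : ℕ} {P : Type*} [Group P] [Finite P]
    [Group.IsNilpotent P] {w v : P} (hwv : Subgroup.closure {w, v} = ⊤)
    (hw : ∀ g, Commute (w ^ p) g)
    (hreg : ∀ R : Subgroup P, R ≠ ⊤ → ∀ x ∈ R, ∀ z ∈ R, (z * x) ^ p = x ^ p ↔ z ^ p = 1) :
    ∀ c ∈ commutator P, c ^ p = 1 := by
  by_cases hQ : Subgroup.normalClosure {w} = (⊤ : Subgroup P)
  · have hz := zpowers_eq_top_of_normalClosure_eq_top hQ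
    have hbot : commutator P = ⊥ := by
      rw [commutator_def, eq_bot_iff, Subgroup.commutator_le]
      intro a _ b _
      obtain ⟨i, rfl⟩ := Subgroup.mem_zpowers_iff.mp (hz ▸ Subgroup.mem_top a)
      obtain ⟨j, rfl⟩ := Subgroup.mem_zpowers_iff.mp (hz ▸ Subgroup.mem_top b)
      rw [Subgroup.mem_bot, commutatorElement_eq_one_iff_commute]
      exact (Commute.refl w).zpow_zpow i j
    rw [hbot]
    rintro c hc
    rw [Subgroup.mem_bot.mp hc, one_pow]
  · have hreg' := hreg _ hQ
    -- Regularity of the proper subgroup `normalClosure {w}` makes its elements of order dividing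
    -- `p` a subgroup. Since `w` and its conjugates share their central `p`-th power, `w` is central
    -- modulo `E`.
    let E : Subgroup P :=
      { carrier := {q | q ∈ Subgroup.normalClosure {w} ∧ q ^ p = 1}
        one_mem' := ⟨one_mem _, one_pow p⟩
        mul_mem' := fun {a b} ha hb =>
          ⟨mul_mem ha.1 hb.1, by rw [(hreg' b hb.1 a ha.1).mpr ha.2, hb.2]⟩
        inv_mem' := fun {a} ha => ⟨inv_mem ha.1, by rw [inv_pow, ha.2, inv_one]⟩ }
    have hE : E.Normal := ⟨fun a ha g => ⟨Subgroup.normalClosure_normal.conj_mem a ha.1 g, by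
      rw [conj_pow, ha.2, mul_one, mul_inv_cancel]⟩⟩
    have hwQ : w ∈ Subgroup.normalClosure ({w} : Set P) :=
      Subgroup.subset_normalClosure (Set.mem_singleton w)
    intro c hc
    refine (commutator_le_of_closure_pair E hwv (fun g => ?_) hc).2
    have hgw : g * w * g⁻¹ ∈ Subgroup.normalClosure ({w} : Set P) :=
      Subgroup.normalClosure_normal.conj_mem w hwQ g
    have heq : ⁅w, g⁆ = w * (g * w * g⁻¹)⁻¹ := by simp [commutatorElement_def, mul_assoc]
    have hmem : ⁅w, g⁆ ∈ Subgroup.normalClosure ({w} : Set P) := heq ▸ mul_mem hwQ (inv_mem hgw)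
    refine ⟨hmem, (hreg' _ hgw _ hmem).mp ?_⟩
    rw [heq, inv_mul_cancel_right, conj_pow, ← (hw g).eq, mul_inv_cancel_right]

namespace CentralPair

variable {p : ℕ}

/-- Induction on the order of a subgroup containing `x` and `z`. The essential case is when they
generate it: under either side of the equivalence one generator has central `p`-th power. -/
theorem mul_pow_eq_iff_of_odd (hp : p.Prime) (hp2 : p ≠ 2) {P : Type*} [Group P] [Finite P]
    {N : Subgroup P} (h : CentralPair p ⊤ N) (x z : P) : (z * x) ^ p = x ^ p ↔ z ^ p = 1 := by
  have hind : ∀ n, ∀ R : Subgroup P, Nat.card R = n → ∀ x ∈ R, ∀ z ∈ R,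
      ((z * x) ^ p = x ^ p ↔ z ^ p = 1) := by
    intro n
    induction n using Nat.strong_induction_on with
    | _ n ih =>
    intro R hR x hx z hz
    by_cases hlt : Subgroup.closure {z, x} < R
    · refine ih _ ?_ (Subgroup.closure {z, x}) rfl x (Subgroup.subset_closure (by simp)) z
        (Subgroup.subset_closure (by simp))
      rw [← hR]
      exact Set.ncard_lt_ncard hlt (Set.toFinite _)
    have hle : Subgroup.closure {z, x} ≤ R := by
      rw [Subgroup.closure_le]
      rintro _ (rfl | rfl) <;> assumption
    have hRP : IsPGroup p R := (h.isPGroup.to_le le_top)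
    have : Fact p.Prime := ⟨hp⟩
    have : Group.IsNilpotent R := hRP.isNilpotent
    have hcl : Subgroup.closure {(⟨z, hz⟩ : R), ⟨x, hx⟩} = ⊤ := by
      rw [← Subgroup.map_subtype_inj, MonoidHom.map_closure, Set.image_pair,
        ← MonoidHom.range_eq_map, Subgroup.range_subtype]
      exact (hle.lt_or_eq).resolve_left hlt
    have hreg : ∀ S : Subgroup R, S ≠ ⊤ → ∀ x ∈ S, ∀ z ∈ S,
        ((z * x) ^ p = x ^ p ↔ z ^ p = 1) := by
      intro S hS a ha b hb
      have hcard : Nat.card (S.map R.subtype) < n := by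
        rw [← hR, Subgroup.card_map_of_injective R.subtype_injective]
        exact lt_of_le_of_ne (Subgroup.card_le_card_group S)
          (fun hc => hS (Subgroup.eq_top_of_card_eq S hc))
      have := ih _ hcard _ rfl a (Subgroup.mem_map_of_mem _ ha) b (Subgroup.mem_map_of_mem _ hb)
      simpa [Subtype.ext_iff] using this
    have main : (∀ c ∈ commutator R, c ^ p = 1) → ((z * x) ^ p = x ^ p ↔ z ^ p = 1) := by
      intro hexp
      have := (h.subgroupOf R).mul_pow_prime hp hp2 hexp ⟨z, hz⟩ ⟨x, hx⟩
      have hzx : (z * x) ^ p = z ^ p * x ^ p := by simpa [Subtype.ext_iff] using this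
      rw [hzx, mul_eq_right]
    constructor
    · intro hzx
      -- Here `x` is the generator with central `p`-th power: `x^p = (z x)^p` commutes with `z x`
      -- and with `x`.
      refine (main (commutator_pow_eq_one_of_proper_regular (Set.pair_comm _ _ ▸ hcl)
        (fun g => ?_) hreg)).mp hzx
      have hle' : Subgroup.closure {(⟨z, hz⟩ : R), ⟨x, hx⟩} ≤
          Subgroup.centralizer {(⟨x, hx⟩ : R) ^ p} := by
        rw [Subgroup.closure_le]
        rintro _ (rfl | rfl) <;> rw [SetLike.mem_coe, Subgroup.mem_centralizer_singleton_iff]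
        · have h1 : Commute (z * x) (x ^ p) := hzx ▸ Commute.self_pow (z * x) p
          have h2 : Commute z (x ^ p) := by
            simpa using h1.mul_left (Commute.self_pow x p).inv_left
          exact Subtype.ext h2.eq
        · exact (Commute.self_pow _ p).eq
      have hg := hle' (hcl ▸ Subgroup.mem_top g)
      rw [Subgroup.mem_centralizer_singleton_iff] at hg
      exact hg.symm
    · intro hz1
      refine (main (commutator_pow_eq_one_of_proper_regular hcl (fun g => ?_) hreg)).mpr hz1
      rw [show (⟨z, hz⟩ : R) ^ p = 1 from Subtype.ext hz1]
      exact Commute.one_left g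
  exact hind _ ⊤ rfl x (Subgroup.mem_top x) z (Subgroup.mem_top z)

theorem mul_pow_prime_eq_iff (hp : p.Prime) {P : Type*} [Group P] [Finite P]
    {N : Subgroup P} (h : CentralPair p ⊤ N) (x z : P) : (z * x) ^ p = x ^ p ↔ z ^ p = 1 := by
  by_cases hp2 : p = 2
  · subst hp2
    exact ⟨h.sq_eq_one_of_mul_sq (Subgroup.mem_top z), h.mul_sq_eq x (Subgroup.mem_top z)⟩
  · exact h.mul_pow_eq_iff_of_odd hp hp2 x z

/-! ### Torsion quotients and `p^n`-th powers -/

variable {P : Type*} [Group P] [Finite P] {Q N : Subgroup P}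

theorem mul_pow_prime_eq_iff_of_mem (hp : p.Prime) (h : CentralPair p Q N) {x z : P} (hx : x ∈ Q)
    (hz : z ∈ Q) : (z * x) ^ p = x ^ p ↔ z ^ p = 1 := by
  simpa [Subtype.ext_iff] using h.restrict.mul_pow_prime_eq_iff hp ⟨x, hx⟩ ⟨z, hz⟩

/-- The elements of `Q` of order dividing `p`. -/
def torsion (hp : p.Prime) (h : CentralPair p Q N) : Subgroup P where
  carrier := {z | z ∈ Q ∧ z ^ p = 1}
  one_mem' := ⟨one_mem _, one_pow p⟩
  mul_mem' := fun {a b} ha hb =>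
    ⟨mul_mem ha.1 hb.1, by rw [(h.mul_pow_prime_eq_iff_of_mem hp hb.1 ha.1).mpr ha.2, hb.2]⟩
  inv_mem' := fun {a} ha => ⟨inv_mem ha.1, by rw [inv_pow, ha.2, inv_one]⟩

theorem torsion_normal (hp : p.Prime) (h : CentralPair p Q N) : (h.torsion hp).Normal :=
  ⟨fun a ha g => ⟨h.normal_left.conj_mem a ha.1 g, by
    rw [conj_pow, ha.2, mul_one, mul_inv_cancel]⟩⟩

/-- An element of `Q` whose `p`-th power is central is central modulo the torsion. -/
theorem commutator_mem_torsion (hp : p.Prime) (h : CentralPair p Q N) {x : P} (hx : x ∈ Q)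
    (g : P) (hxg : Commute (x ^ p) g) : ⁅x, g⁆ ∈ h.torsion hp := by
  have hgx : g * x * g⁻¹ ∈ Q := h.normal_left.conj_mem x hx g
  have heq : ⁅x, g⁆ = x * (g * x * g⁻¹)⁻¹ := by simp [commutatorElement_def, mul_assoc]
  have hmem : ⁅x, g⁆ ∈ Q := heq ▸ mul_mem hx (inv_mem hgx)
  refine ⟨hmem, (h.mul_pow_prime_eq_iff_of_mem hp hgx hmem).mp ?_⟩
  rw [heq, inv_mul_cancel_right, conj_pow, ← hxg.eq, mul_inv_cancel_right]

/-- `P` need not be a `p`-group here. As `z` is central modulo the torsion of `Q`, the commutator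
subgroup of `⟨z, x⟩` lies in that torsion. -/
theorem mul_pow_prime_eq (hp : p.Prime) (h : CentralPair p Q N) (x : P) {z : P} (hz : z ∈ Q)
    (hz1 : z ^ p = 1) : (z * x) ^ p = x ^ p := by
  by_cases hp2 : p = 2
  · subst hp2
    exact h.mul_sq_eq x hz hz1
  set R := Subgroup.closure {z, x} with hR
  have hzR : z ∈ R := Subgroup.subset_closure (by simp)
  have hxR : x ∈ R := Subgroup.subset_closure (by simp)
  have hcl : Subgroup.closure {(⟨z, hzR⟩ : R), ⟨x, hxR⟩} = ⊤ := by
    rw [← Subgroup.map_subtype_inj, MonoidHom.map_closure, Set.image_pair,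
      ← MonoidHom.range_eq_map, Subgroup.range_subtype]
    exact hR.symm
  have := (h.torsion_normal hp).subgroupOf R
  have hexp : ∀ c ∈ commutator R, c ^ p = 1 := fun c hc => by
    have := commutator_le_of_closure_pair ((h.torsion hp).subgroupOf R) hcl (fun g => by
      rw [Subgroup.mem_subgroupOf]
      exact h.commutator_mem_torsion hp hz g (by rw [hz1]; exact Commute.one_left _)) hc
    exact Subtype.ext this.2
  have := (h.subgroupOf R).mul_pow_prime hp hp2 hexp ⟨z, hzR⟩ ⟨x, hxR⟩
  simpa [Subtype.ext_iff, hz1] using this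

theorem pow_prime_eq_one (hp : p.Prime) (h : CentralPair p Q N) (hP : IsPGroup p P) {x z : P}
    (hz : z ∈ Q) (hzx : (z * x) ^ p = x ^ p) : z ^ p = 1 := by
  by_cases hp2 : p = 2
  · subst hp2
    exact h.sq_eq_one_of_mul_sq hz hzx
  have h' : CentralPair p ⊤ N :=
    { normal_left := inferInstance
      normal_right := h.normal_right
      le := le_top
      isPGroup := hP.to_subgroup ⊤
      le_of_two := fun hp => absurd hp hp2
      lowerCentralSeries_le := h.lowerCentralSeries_le
      central := h.central }
  exact (h'.mul_pow_prime_eq_iff hp x z).mp hzx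

theorem quotient (hp : p.Prime) (h : CentralPair p Q N) [(h.torsion hp).Normal] :
    CentralPair p (Q.map (QuotientGroup.mk' (h.torsion hp)))
      (N.map (QuotientGroup.mk' (h.torsion hp))) where
  normal_left := h.normal_left.map _ (QuotientGroup.mk'_surjective _)
  normal_right := h.normal_right.map _ (QuotientGroup.mk'_surjective _)
  le := Subgroup.map_mono h.le
  isPGroup := h.isPGroup.map _
  le_of_two hp2 := Subgroup.map_mono (h.le_of_two hp2)
  lowerCentralSeries_le hp2 := by
    have htop : (⊤ : Subgroup (P ⧸ h.torsion hp)) =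
        (⊤ : Subgroup P).map (QuotientGroup.mk' (h.torsion hp)) :=
      (Subgroup.map_top_of_surjective _ (QuotientGroup.mk'_surjective _)).symm
    rw [htop, ← Subgroup.map_lowerCentralSeries]
    exact Subgroup.map_mono (h.lowerCentralSeries_le hp2)
  central := by
    rintro _ ⟨x, hx, rfl⟩ hxe g
    obtain ⟨g, rfl⟩ := QuotientGroup.mk'_surjective _ g
    rw [← map_pow, QuotientGroup.mk'_apply, QuotientGroup.eq_one_iff] at hxe
    -- With `e` equal to `p`, or 4 if `p = 2`, the relation `(x^e)^p = 1` also reads `(x^p)^e = 1`,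
    -- so `x^p` is central.
    have hcomm := h.commutator_mem_torsion hp (h.le hx) g
      (h.central _ (pow_mem hx p) (by rw [pow_right_comm]; exact hxe.2) g)
    rw [← QuotientGroup.eq_one_iff] at hcomm
    exact commutatorElement_eq_one_iff_commute.mp hcomm

/-- Modulo the torsion `z^(p^n)` dies, so by induction `(z x)^(p^n)` and `x^(p^n)` differ by a
torsion factor, which one more `p`-th power removes. -/
theorem mul_pow_prime_pow_eq (hp : p.Prime) (n : ℕ) : ∀ {P : Type*} [Group P] [Finite P]
    {Q N : Subgroup P}, CentralPair p Q N → ∀ (x : P) {z : P}, z ∈ Q → z ^ p ^ n = 1 →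
    (z * x) ^ p ^ n = x ^ p ^ n := by
  induction n with
  | zero => intro P _ _ Q N h x z hz hz1; simp_all
  | succ n ih =>
    intro P _ _ Q N h x z hz hz1
    have := h.torsion_normal hp
    have hzE : z ^ p ^ n ∈ h.torsion hp := ⟨pow_mem hz _, by rw [← pow_mul, ← pow_succ, hz1]⟩
    have hq := ih (h.quotient hp) (QuotientGroup.mk' _ x) (Subgroup.mem_map_of_mem _ hz)
      (by rw [← map_pow]; exact (QuotientGroup.eq_one_iff _).mpr hzE)
    rw [← map_mul, ← map_pow, ← map_pow, ← mul_inv_eq_one, ← map_inv, ← map_mul] at hq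
    have hE := (QuotientGroup.eq_one_iff _).mp hq
    have := h.mul_pow_prime_eq hp (x ^ p ^ n) hE.1 hE.2
    rwa [inv_mul_cancel_right, ← pow_mul, ← pow_mul, ← pow_succ] at this

theorem pow_prime_pow_eq_one (hp : p.Prime) (n : ℕ) : ∀ {P : Type*} [Group P] [Finite P]
    {Q N : Subgroup P}, CentralPair p Q N → IsPGroup p P → ∀ {x z : P}, z ∈ Q →
    (z * x) ^ p ^ n = x ^ p ^ n → z ^ p ^ n = 1 := by
  induction n with
  | zero => intro P _ _ Q N h hP x z hz hzx; simpa using hzx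
  | succ n ih =>
    intro P _ _ Q N h hP x z hz hzx
    have := h.torsion_normal hp
    have := h.normal_left
    have hmem : (z * x) ^ p ^ n * (x ^ p ^ n)⁻¹ ∈ Q := by
      rw [← QuotientGroup.eq_one_iff]
      simp [(QuotientGroup.eq_one_iff z).mpr hz]
    have hE : (z * x) ^ p ^ n * (x ^ p ^ n)⁻¹ ∈ h.torsion hp := by
      refine ⟨hmem, h.pow_prime_eq_one hp hP (x := x ^ p ^ n) hmem ?_⟩
      rw [inv_mul_cancel_right, ← pow_mul, ← pow_mul, ← pow_succ, hzx]
    have hq := ih (h.quotient hp) (hP.to_quotient _) (x := QuotientGroup.mk' _ x)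
      (Subgroup.mem_map_of_mem _ hz) (by
        rw [← map_mul, ← map_pow, ← map_pow, ← mul_inv_eq_one, ← map_inv, ← map_mul]
        exact (QuotientGroup.eq_one_iff _).mpr hE)
    rw [← map_pow] at hq
    rw [pow_succ, pow_mul]
    exact ((QuotientGroup.eq_one_iff _).mp hq).2

end CentralPair

/-! ### Commutator series in the semidirect product -/

section Semidirect

variable {G A : Type*} [Group G] [Group A] (φ : A →* MulAut G)

theorem leftNormed_append_singleton {K : Type*} [Group K] (x : K) (l : List K) (y : K) :
    leftNormed x (l ++ [y]) = (leftNormed x l)⁻¹ * y⁻¹ * leftNormed x l * y := by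
  simp [leftNormed]

theorem rightHom_leftNormed_inl (x : G) (l : List (G ⋊[φ] A)) :
    SemidirectProduct.rightHom (leftNormed (SemidirectProduct.inl x : G ⋊[φ] A) l) = 1 := by
  induction l using List.reverseRecOn with
  | nil => simp [leftNormed]
  | append_singleton l y ih =>
    rw [leftNormed_append_singleton, map_mul, map_mul, map_mul, map_inv, map_inv, ih]
    simp

/-- `γ_k(G, A)` as a subgroup of the semidirect product. -/
def gammaSemidirect (k : ℕ) : Subgroup (G ⋊[φ] A) :=
  Subgroup.closure {w | ∃ (x : G) (l : List (G ⊕ A)),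
    k ≤ l.countP (fun z => z.isRight) + 1 ∧
    w = leftNormed (SemidirectProduct.inl x) (l.map (letter φ))}

theorem gammaSemidirect_antitone : Antitone (gammaSemidirect φ) := fun _ _ hij =>
  Subgroup.closure_mono fun _ ⟨x, l, hl, hw⟩ => ⟨x, l, hij.trans hl, hw⟩

theorem gammaSemidirect_le_map (k : ℕ) :
    gammaSemidirect φ k ≤ (gammaSeries φ k).map SemidirectProduct.inl := by
  rw [gammaSemidirect, Subgroup.closure_le]
  rintro _ ⟨x, l, hl, rfl⟩
  have h := rightHom_leftNormed_inl φ x (l.map (letter φ))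
  rw [← MonoidHom.mem_ker, ← SemidirectProduct.range_inl_eq_ker_rightHom] at h
  obtain ⟨g, hg⟩ := h
  exact ⟨g, Subgroup.subset_closure ⟨x, l, hl, hg⟩, hg⟩

theorem conj_letter_mem_gammaSemidirect {k : ℕ} (y : G ⊕ A) {w : G ⋊[φ] A}
    (hw : w ∈ gammaSemidirect φ k) : (letter φ y)⁻¹ * w * letter φ y ∈ gammaSemidirect φ k := by
  have h : gammaSemidirect φ k ≤
      (gammaSemidirect φ k).comap (MulAut.conj (letter φ y)⁻¹).toMonoidHom := by
    conv_lhs => rw [gammaSemidirect]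
    rw [Subgroup.closure_le]
    rintro _ ⟨x, l, hl, rfl⟩
    have h1 : leftNormed (SemidirectProduct.inl x) (l.map (letter φ)) ∈ gammaSemidirect φ k :=
      Subgroup.subset_closure ⟨x, l, hl, rfl⟩
    have h2 : leftNormed (SemidirectProduct.inl x) ((l ++ [y]).map (letter φ)) ∈
        gammaSemidirect φ k :=
      Subgroup.subset_closure ⟨x, l ++ [y], by rw [List.countP_append]; omega, rfl⟩
    rw [List.map_append, List.map_singleton, leftNormed_append_singleton] at h2
    simpa [mul_assoc] using mul_mem h1 h2
  simpa using h hw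

theorem gammaSemidirect_normal (k : ℕ) : (gammaSemidirect φ k).Normal := by
  refine ⟨fun w hw u => ?_⟩
  have h1 := conj_letter_mem_gammaSemidirect φ (Sum.inr u.right⁻¹) hw
  have h2 := conj_letter_mem_gammaSemidirect φ (Sum.inl u.left⁻¹) h1
  have h : u * w * u⁻¹ = (letter φ (Sum.inl u.left⁻¹))⁻¹ *
      ((letter φ (Sum.inr u.right⁻¹))⁻¹ * w * letter φ (Sum.inr u.right⁻¹)) *
      letter φ (Sum.inl u.left⁻¹) := by
    conv_lhs => rw [← SemidirectProduct.inl_left_mul_inr_right u]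
    simp only [letter, map_inv, inv_inv, mul_inv_rev, mul_assoc]
  rwa [h]

/-- The normal closure of `A` in the semidirect product. -/
def actorClosure : Subgroup (G ⋊[φ] A) :=
  Subgroup.normalClosure (Set.range SemidirectProduct.inr)

instance actorClosure_normal : (actorClosure φ).Normal := Subgroup.normalClosure_normal

theorem inr_mem_actorClosure (a : A) : SemidirectProduct.inr a ∈ actorClosure φ :=
  Subgroup.subset_normalClosure ⟨a, rfl⟩

/-- Appending a letter of `A` shows that `A` centralizes `γ_k` modulo `γ_{k+1}`. The centralizer of
a normal subgroup is normal, so it contains the normal closure of `A`. -/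
theorem commutator_gammaSemidirect_le (k : ℕ) :
    ⁅gammaSemidirect φ k, actorClosure φ⁆ ≤ gammaSemidirect φ (k + 1) := by
  have hk := gammaSemidirect_normal φ k
  have hk1 := gammaSemidirect_normal φ (k + 1)
  set π := QuotientGroup.mk' (gammaSemidirect φ (k + 1))
  have hmap : ((gammaSemidirect φ k).map π).Normal :=
    hk.map _ (QuotientGroup.mk'_surjective _)
  have hle : actorClosure φ ≤ (Subgroup.centralizer
      ((gammaSemidirect φ k).map π : Set _)).comap π := by
    refine Subgroup.normalClosure_le_normal ?_
    rintro _ ⟨a, rfl⟩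
    rw [SetLike.mem_coe, Subgroup.mem_comap, Subgroup.mem_centralizer_iff]
    rintro _ ⟨w, hw, rfl⟩
    have hle : gammaSemidirect φ k ≤
        (Subgroup.centralizer {π (SemidirectProduct.inr a)}).comap π := by
      conv_lhs => rw [gammaSemidirect]
      rw [Subgroup.closure_le]
      rintro _ ⟨x, l, hl, rfl⟩
      rw [SetLike.mem_coe, Subgroup.mem_comap, Subgroup.mem_centralizer_singleton_iff]
      have h : leftNormed (SemidirectProduct.inl x) ((l ++ [Sum.inr a]).map (letter φ)) ∈
          gammaSemidirect φ (k + 1) :=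
        Subgroup.subset_closure ⟨x, l ++ [Sum.inr a], by simpa [List.countP_append] using hl, rfl⟩
      rw [List.map_append, List.map_singleton, leftNormed_append_singleton, mul_assoc,
        ← mul_inv_rev, ← QuotientGroup.eq] at h
      exact h.symm
    exact Subgroup.mem_centralizer_singleton_iff.mp (hle hw)
  rw [Subgroup.commutator_le]
  intro w hw u hu
  rw [← QuotientGroup.eq_one_iff]
  exact commutatorElement_eq_one_iff_mul_comm.mpr
    (Subgroup.mem_centralizer_iff.mp (hle hu) (π w) (Subgroup.mem_map_of_mem _ hw))

/-- As `γ_p` is normal, `A` fixes every conjugate of `w`; equivalently, `w` commutes with every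
conjugate of `A`. -/
theorem commute_of_mem_actorClosure {p : ℕ} (hA : ActsPCentrally φ p (gammaSeries φ p))
    {w u : G ⋊[φ] A} (hw : w ∈ gammaSemidirect φ p) (hwp : w ^ (if p = 2 then 4 else p) = 1)
    (hu : u ∈ actorClosure φ) : Commute w u := by
  suffices h : actorClosure φ ≤ Subgroup.centralizer {w} from
    (Subgroup.mem_centralizer_singleton_iff.mp (h hu)).symm
  rw [actorClosure, Subgroup.normalClosure, Subgroup.closure_le]
  intro v hv
  obtain ⟨_, ⟨a, rfl⟩, hv⟩ := Group.mem_conjugatesOfSet_iff.mp hv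
  obtain ⟨c, rfl⟩ := isConj_iff.mp hv
  have hmem : c⁻¹ * w * c ∈ gammaSemidirect φ p := by
    simpa using (gammaSemidirect_normal φ p).conj_mem w hw c⁻¹
  obtain ⟨g, hg, hgw⟩ := gammaSemidirect_le_map φ p hmem
  have hg1 : g ^ (if p = 2 then 4 else p) = 1 := by
    apply SemidirectProduct.inl_injective (φ := φ)
    have := conj_pow (i := if p = 2 then 4 else p) (a := c⁻¹) (b := w)
    rw [inv_inv, hwp, mul_one, inv_mul_cancel] at this
    rw [map_pow, hgw, this, map_one]
  have hfix := hA g hg hg1 a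
  have h1 : (SemidirectProduct.inr a : G ⋊[φ] A) * (c⁻¹ * w * c) * SemidirectProduct.inr a⁻¹ =
      c⁻¹ * w * c := by
    rw [← hgw, ← SemidirectProduct.inl_aut, hfix]
  rw [map_inv, mul_inv_eq_iff_eq_mul] at h1
  rw [SetLike.mem_coe, Subgroup.mem_centralizer_singleton_iff]
  calc c * SemidirectProduct.inr a * c⁻¹ * w
      = c * (SemidirectProduct.inr a * (c⁻¹ * w * c)) * c⁻¹ := by simp [mul_assoc]
    _ = w * (c * SemidirectProduct.inr a * c⁻¹) := by rw [h1]; simp [mul_assoc]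

/-- The intersection of `γ_k(G, A)` with the normal closure of `A`. -/
def gammaActor (k : ℕ) : Subgroup (G ⋊[φ] A) := gammaSemidirect φ k ⊓ actorClosure φ

theorem gammaActor_normal (k : ℕ) : (gammaActor φ k).Normal := by
  have := gammaSemidirect_normal φ k
  exact Subgroup.normal_inf_normal _ _

theorem inl_mem_gammaActor {h : G} (hh : h ∈ actionCommutator φ) :
    SemidirectProduct.inl h ∈ gammaActor φ 2 := by
  suffices hle : actionCommutator φ ≤ (gammaActor φ 2).comap SemidirectProduct.inl from hle hh
  rw [actionCommutator, Subgroup.closure_le]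
  rintro _ ⟨g, a, rfl⟩
  have heq : (SemidirectProduct.inl (g⁻¹ * φ a g) : G ⋊[φ] A) =
      (SemidirectProduct.inl g)⁻¹ * SemidirectProduct.inr a * SemidirectProduct.inl g *
        (SemidirectProduct.inr a)⁻¹ := by
    simp [SemidirectProduct.inl_aut, mul_assoc]
  rw [SetLike.mem_coe, Subgroup.mem_comap, heq]
  refine Subgroup.mem_inf.mpr ⟨?_, ?_⟩
  · exact Subgroup.subset_closure ⟨g, [Sum.inr a⁻¹], by simp, by simp [leftNormed, letter]⟩
  · have ha := inr_mem_actorClosure φ a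
    refine mul_mem ?_ (inv_mem ha)
    simpa using (actorClosure_normal φ).conj_mem _ ha (SemidirectProduct.inl g)⁻¹

/-- The subgroup of the semidirect product generated by `a` and `gammaActor φ 2`. -/
def actorExtension (a : A) : Subgroup (G ⋊[φ] A) :=
  gammaActor φ 2 ⊔ Subgroup.zpowers (SemidirectProduct.inr a)

theorem actorExtension_le (a : A) : actorExtension φ a ≤ actorClosure φ :=
  sup_le inf_le_right ((Subgroup.zpowers_le).mpr (inr_mem_actorClosure φ a))

/-- Since `⟨a⟩` is abelian, the first commutators already lie in `γ_3`. This gain of one step is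
what puts the `(p - 2)`-nd term inside `γ_p`. -/
theorem lowerCentralSeries_actorExtension_le (a : A) (i : ℕ) :
    (actorExtension φ a).lowerCentralSeries (i + 1) ≤ gammaSemidirect φ (i + 3) := by
  induction i with
  | zero =>
    have h3 := gammaSemidirect_normal φ 3
    have h2 := gammaActor_normal φ 2
    have hq : ∀ q ∈ gammaActor φ 2, ∀ u ∈ actorClosure φ,
        Commute (q : (G ⋊[φ] A) ⧸ gammaSemidirect φ 3) (u : (G ⋊[φ] A) ⧸ gammaSemidirect φ 3) := by
      intro q hq u hu
      rw [← commutatorElement_eq_one_iff_commute]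
      exact (QuotientGroup.eq_one_iff _).mpr (commutator_gammaSemidirect_le φ 2
        (Subgroup.commutator_mem_commutator hq.1 hu))
    rw [Subgroup.lowerCentralSeries_succ, Subgroup.lowerCentralSeries_zero, Subgroup.commutator_le]
    intro u hu v hv
    obtain ⟨q, hq1, s, hs, rfl⟩ := Subgroup.mem_sup_of_normal_left.mp hu
    obtain ⟨r, hr1, t, ht, rfl⟩ := Subgroup.mem_sup_of_normal_left.mp hv
    have hsK := actorExtension_le φ a (Subgroup.mem_sup_right hs)
    have htK := actorExtension_le φ a (Subgroup.mem_sup_right ht)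
    obtain ⟨i, rfl⟩ := Subgroup.mem_zpowers_iff.mp hs
    obtain ⟨j, rfl⟩ := Subgroup.mem_zpowers_iff.mp ht
    have hc : Commute ((SemidirectProduct.inr a : G ⋊[φ] A) ^ i) (SemidirectProduct.inr a ^ j) :=
      (Commute.refl _).zpow_zpow i j
    exact (QuotientGroup.eq_one_iff _).mp (commutatorElement_eq_one_iff_commute.mpr
      ((hq q hq1 _ (mul_mem hr1.2 htK)).mul_left ((hq r hr1 _ hsK).symm.mul_right
        (hc.map (QuotientGroup.mk' (gammaSemidirect φ 3))))))
  | succ i ih =>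
    rw [Subgroup.lowerCentralSeries_succ]
    exact (Subgroup.commutator_mono ih (actorExtension_le φ a)).trans
      (commutator_gammaSemidirect_le φ _)

/-- The product of `g⁻¹ gᵃ` and `a` is the conjugate of `a` by `g`, so it has the same `m`-th power
as `a` exactly when `a ^ m` fixes `g`. -/
theorem inl_mul_inr_pow_eq_iff (a : A) (g : G) (m : ℕ) :
    (SemidirectProduct.inl (g⁻¹ * φ a g) * SemidirectProduct.inr a : G ⋊[φ] A) ^ m =
      SemidirectProduct.inr a ^ m ↔ φ (a ^ m) g = g := by
  have h1 : (SemidirectProduct.inl (g⁻¹ * φ a g) * SemidirectProduct.inr a : G ⋊[φ] A) =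
      SemidirectProduct.inl g⁻¹ * SemidirectProduct.inr a * (SemidirectProduct.inl g⁻¹)⁻¹ := by
    simp [SemidirectProduct.inl_aut, mul_assoc]
  have h2 : (SemidirectProduct.inl (φ (a ^ m) g) : G ⋊[φ] A) =
      SemidirectProduct.inr a ^ m * SemidirectProduct.inl g * (SemidirectProduct.inr a ^ m)⁻¹ := by
    rw [SemidirectProduct.inl_aut, map_inv, map_pow]
  rw [h1, conj_pow, ← SemidirectProduct.inl_inj (φ := φ), h2, map_inv, inv_inv,
    mul_inv_eq_iff_eq_mul, mul_assoc, inv_mul_eq_iff_eq_mul]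

variable {p : ℕ}

theorem isPGroup_gammaActor (hG : IsPGroup p G) (k : ℕ) : IsPGroup p (gammaActor φ k) := by
  have h : IsPGroup p (SemidirectProduct.inl : G →* G ⋊[φ] A).range :=
    hG.of_surjective _ (MonoidHom.rangeRestrict_surjective _)
  refine h.to_le (inf_le_left.trans ((gammaSemidirect_le_map φ k).trans ?_))
  exact Subgroup.map_le_range _ _

theorem isPGroup_actorExtension (hG : IsPGroup p G) {a : A} {n : ℕ} (ha : a ^ p ^ n = 1) :
    IsPGroup p (actorExtension φ a) := by
  have := gammaActor_normal φ 2
  refine (isPGroup_gammaActor φ hG 2).to_sup_of_normal_left ?_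
  rintro ⟨_, hs⟩
  obtain ⟨i, rfl⟩ := Subgroup.mem_zpowers_iff.mp hs
  refine ⟨n, Subtype.ext ?_⟩
  change ((SemidirectProduct.inr a : G ⋊[φ] A) ^ i) ^ p ^ n = 1
  rw [← zpow_natCast, zpow_comm, zpow_natCast, ← map_pow, ha, map_one, one_zpow]

theorem centralPair_actorExtension (hp : p.Prime) (hG : IsPGroup p G)
    (hA : ActsPCentrally φ p (gammaSeries φ p)) (a : A) :
    CentralPair p ((gammaActor φ 2).subgroupOf (actorExtension φ a))
      ((gammaActor φ p).subgroupOf (actorExtension φ a)) where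
  normal_left := (gammaActor_normal φ 2).comap _
  normal_right := (gammaActor_normal φ p).comap _
  le := Subgroup.comap_mono (inf_le_inf_right _ (gammaSemidirect_antitone φ hp.two_le))
  isPGroup := (isPGroup_gammaActor φ hG 2).comap_subtype
  le_of_two hp2 := by rw [hp2]
  lowerCentralSeries_le hp2 := by
    have h2 := hp.two_le
    rw [Subgroup.subgroupOf, ← Subgroup.map_le_iff_le_comap,
      Subgroup.top_subtype_lowerCentralSeries]
    refine le_inf ?_ ((Subgroup.lowerCentralSeries_le_self _ _).trans (actorExtension_le φ a))
    have h := lowerCentralSeries_actorExtension_le φ a (p - 3)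
    rwa [show p - 3 + 1 = p - 2 by omega, show p - 3 + 3 = p by omega] at h
  central w hw hwp u := Subtype.ext (commute_of_mem_actorClosure φ hA hw.1
    (congrArg Subtype.val hwp) (actorExtension_le φ a u.2)).eq

/-! ### Transfer of regularity to the action -/

variable [Finite G] [Finite A]

instance finite_semidirectProduct : Finite (G ⋊[φ] A) :=
  Finite.of_equiv _ SemidirectProduct.equivProd.symm

/-- The elements of `[G, A]` of order dividing `p ^ n` form a subgroup. -/
theorem pow_eq_one_of_mem_omega (hp : p.Prime) (hG : IsPGroup p G)
    (hA : ActsPCentrally φ p (gammaSeries φ p)) (n : ℕ) {x : G}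
    (hx : x ∈ omega p n (actionCommutator φ)) : x ^ p ^ n = 1 := by
  -- Only products inside `[G, A]` matter, so the trivial actor suffices.
  have hP := centralPair_actorExtension φ hp hG hA 1
  have hmem : ∀ h ∈ actionCommutator φ, SemidirectProduct.inl h ∈ gammaActor φ 2 :=
    fun h hh => inl_mem_gammaActor φ hh
  suffices h : x ∈ actionCommutator φ ∧ x ^ p ^ n = 1 from h.2
  induction hx using Subgroup.closure_induction with
  | mem x hx => exact hx
  | one => exact ⟨one_mem _, one_pow _⟩
  | mul x y _ _ hx hy =>
    refine ⟨mul_mem hx.1 hy.1, ?_⟩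
    have h := hP.mul_pow_prime_pow_eq hp n
      (⟨_, Subgroup.mem_sup_left (hmem y hy.1)⟩ : actorExtension φ 1)
      (z := ⟨_, Subgroup.mem_sup_left (hmem x hx.1)⟩) (hmem x hx.1)
      (Subtype.ext (by simp [← map_pow, hx.2]))
    have h' := congrArg Subtype.val h
    simp only [Subgroup.coe_pow, Subgroup.coe_mul, ← map_mul, ← map_pow] at h'
    rw [SemidirectProduct.inl_injective h', hy.2]
  | inv x _ hx => exact ⟨inv_mem hx.1, by rw [inv_pow, hx.2, inv_one]⟩

theorem pow_prime_pow_eq_one_iff (hp : p.Prime) (hG : IsPGroup p G)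
    (hA : ActsPCentrally φ p (gammaSeries φ p)) (hφ : Function.Injective φ) (n : ℕ) (a : A) :
    a ^ p ^ n = 1 ↔ ∀ g : G, (g⁻¹ * φ a g) ^ p ^ n = 1 := by
  have hP := centralPair_actorExtension φ hp hG hA a
  have hz : ∀ g, SemidirectProduct.inl (g⁻¹ * φ a g) ∈ gammaActor φ 2 := fun g =>
    inl_mem_gammaActor φ (Subgroup.subset_closure ⟨g, a, rfl⟩)
  let x : actorExtension φ a := ⟨_, Subgroup.mem_sup_right (Subgroup.mem_zpowers _)⟩
  let z : G → actorExtension φ a := fun g => ⟨_, Subgroup.mem_sup_left (hz g)⟩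
  have hzx : ∀ g, (z g * x) ^ p ^ n = x ^ p ^ n ↔ φ (a ^ p ^ n) g = g := fun g => by
    rw [← inl_mul_inr_pow_eq_iff, Subtype.ext_iff]; rfl
  have hz1 : ∀ g, z g ^ p ^ n = 1 ↔ (g⁻¹ * φ a g) ^ p ^ n = 1 := fun g => by
    rw [← SemidirectProduct.inl_inj (φ := φ), map_pow, map_one, Subtype.ext_iff]; rfl
  constructor
  · intro ha g
    rw [← hz1]
    -- The extension by `a` is known to be a `p`-group only in this direction, where `a^(p^n) = 1`;
    -- the converse does not need it.
    exact hP.pow_prime_pow_eq_one hp n (isPGroup_actorExtension φ hG ha) (hz g)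
      ((hzx g).mpr (by rw [ha, map_one, MulAut.one_apply]))
  · intro h
    refine hφ (MulEquiv.ext fun g => ?_)
    rw [map_one, MulAut.one_apply, ← hzx]
    exact hP.mul_pow_prime_pow_eq hp n x (hz g) ((hz1 g).mpr (h g))

end Semidirect

end PCentral

theorem propositionP8 (p : ℕ) (hp : p.Prime) (G : Type*) [Group G] [Finite G]
    (hG : IsPGroup p G) (A : Subgroup (MulAut G))
    (hA : PCentral.ActsPCentrally A.subtype p (PCentral.gammaSeries A.subtype p))
    (n : ℕ) (σ : MulAut G) (hσ : σ ∈ A) :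
    σ ^ p ^ n = 1 ↔
      PCentral.ActsTriviallyOnQuotient σ
        (PCentral.omega p n (PCentral.actionCommutator A.subtype)) := by
  have : Finite (MulAut G) := Finite.of_injective (fun f : MulAut G => (f : G → G))
    DFunLike.coe_injective
  have h := PCentral.pow_prime_pow_eq_one_iff A.subtype hp hG hA A.subtype_injective n ⟨σ, hσ⟩
  rw [Subtype.ext_iff] at h
  refine h.trans (forall_congr' fun g => ?_)
  rw [@eq_comm (G ⧸ _), QuotientGroup.eq]
  exact ⟨fun hg => Subgroup.subset_closure ⟨Subgroup.subset_closure ⟨g, ⟨σ, hσ⟩, rfl⟩, hg⟩,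
    PCentral.pow_eq_one_of_mem_omega A.subtype hp hG hA n⟩
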